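/- For $D\ge 0$ qubits let $d_p=\binom{D}{p}$, $p=0,\dots,D$, be the dimensions of the charge sectors of the $2^D$-dimensional Hilbert space. The $U(1)$-symmetric Haar ensemble is the law of the random block-diagonal unitary $U=\bigoplus_{p=0}^{D}U_p$, where the $U_p$ are independent and $U_p$ is distributed according to the normalized Haar measure on the unitary group $\mathrm U(d_p)$. For a random unitary ensemble $\mathcal E$ let $R_{2k}^{\mathcal E}=\int_{\mathcal E}|\mathrm{Tr}\,U|^{2k}\,dU$ be its $2k$-point spectral form factor, and write $R_{2k}(D)$ for that of the $U(1)$-symmetric Haar ensemble and $R_2^{\mathcal H}(d)$ for the two-point form factor of the Haar measure on $\mathrm U(d)$. (1) $R_{2k}(D)\sim k!\,D^k$ for $D\gg k$: for every $\varepsilon>0$ there is $\delta>0$ such that for all integers $D,k\ge 0$ with $k\le\delta D$, $$\bigl|R_{2k}(D)-k!\,D^k\bigr|\le\varepsilon\,k!\,D^k .$$ (2) The leading term comes from $k$ distinct charge sectors, each contributing its Haar two-point form factor. In detail, let $$C_k(D)=\sum_{\substack{p_1,\dots,p_k\in\{0,\dots,D\}\\ \text{distinct}}}\ \sum_{s\in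 S_k}\int \prod_{i=1}^k \mathrm{Tr}(U_{p_i})\,\overline{\mathrm{Tr}(U_{p_{s(i)}})}\;dU$$ be the contribution of $k$ distinct sectors to the expansion of $R_{2k}(D)=\int|\sum_p\mathrm{Tr}\,U_p|^{2k}dU$. Then $R_2^{\mathcal H}(d_p)=1$ for every sector $p$; for all $D,k\ge 0$, $$C_k(D)=k!\sum_{\substack{p_1,\dots,p_k\\ \text{distinct}}}\ \prod_{i=1}^k R_2^{\mathcal H}(d_{p_i});$$ and for every $\varepsilon>0$ there is $\delta>0$ such that $|R_{2k}(D)-C_k(D)|\le\varepsilon\,R_{2k}(D)$ for all integers $D,k\ge0$ with $k^2\le\delta D$. -/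

import Mathlib

open MeasureTheory

/-! ### The unitary group and its normalized Haar measure -/

/-- The Borel `σ`-algebra of the unitary group, a subspace of the matrices. -/
noncomputable instance unitaryMeasurableSpace {n : Type} [Fintype n] [DecidableEq n] :
    MeasurableSpace (Matrix.unitaryGroup n ℂ) := borel _

instance unitaryBorelSpace {n : Type} [Fintype n] [DecidableEq n] :
    BorelSpace (Matrix.unitaryGroup n ℂ) := ⟨rfl⟩

instance unitarySecondCountable {n : Type} [Fintype n] [DecidableEq n] :
    SecondCountableTopology (Matrix.unitaryGroup n ℂ) := by
  have : SecondCountableTopology (Matrix n n ℂ) :=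
    inferInstanceAs (SecondCountableTopology (n → n → ℂ))
  exact TopologicalSpace.Subtype.secondCountableTopology _

instance unitaryCompactSpace {n : Type} [Fintype n] [DecidableEq n] :
    CompactSpace (Matrix.unitaryGroup n ℂ) := by
  have hK : IsCompact {A : Matrix n n ℂ | ∀ i j, A i j ∈ Metric.closedBall (0 : ℂ) 1} := by
    have h : IsCompact {A : n → n → ℂ | ∀ i j, A i j ∈ Metric.closedBall (0 : ℂ) 1} :=
      isCompact_pi_infinite fun _ => isCompact_pi_infinite fun _ => isCompact_closedBall (0 : ℂ) 1
    exact h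
  refine isCompact_iff_compactSpace.mp (hK.of_isClosed_subset ?_ ?_)
  · have h : (Matrix.unitaryGroup n ℂ : Set (Matrix n n ℂ)) =
        {A : Matrix n n ℂ | A * star A = 1} := by
      ext A
      exact Matrix.mem_unitaryGroup_iff
    rw [h]
    exact isClosed_eq (continuous_id.mul continuous_star) continuous_const
  · intro A hA i j
    simpa using entry_norm_bound_of_unitary hA i j

/-- The Haar ensemble: the invariant Borel measure of total mass `1` on the unitary group. -/
noncomputable def haarUnitary (n : Type) [Fintype n] [DecidableEq n] :
    Measure (Matrix.unitaryGroup n ℂ) :=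
  Measure.haarMeasure ⊤

instance haarUnitaryIsProbability {n : Type} [Fintype n] [DecidableEq n] :
    IsProbabilityMeasure (haarUnitary n) :=
  ⟨by simpa [haarUnitary] using
    Measure.haarMeasure_self (K₀ := (⊤ : TopologicalSpace.PositiveCompacts
      (Matrix.unitaryGroup n ℂ)))⟩

/-! ### Spectral form factors -/

/-- The `2k`-point spectral form factor `∫ |Tr U| ^ (2k) dU` of a random unitary ensemble, the
ensemble being given by its law `E` on the unitary group. -/
noncomputable def formFactor {n : Type} [Fintype n] [DecidableEq n]
    (E : Measure (Matrix.unitaryGroup n ℂ)) (k : ℕ) : ℝ :=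
  ∫ U, ‖(U : Matrix n n ℂ).trace‖ ^ (2 * k) ∂E

/-! ### The `U(1)`-symmetric Haar ensemble on `D` qubits -/

/-- Basis labels of the charge sector `p` of `D` qubits, which has dimension `D.choose p`;
the charge `p` runs over `0, …, D`. -/
abbrev Sector (D : ℕ) (p : Fin (D + 1)) : Type := Fin (D.choose p)

/-- Basis labels `(p, i)` of the whole `2 ^ D`-dimensional space. -/
abbrev QubitBasis (D : ℕ) : Type := Σ p : Fin (D + 1), Sector D p

/-- The block-diagonal unitary `⨁ₚ Uₚ` with one unitary block for each charge sector. -/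
def directSumUnitary (D : ℕ) (U : ∀ p : Fin (D + 1), Matrix.unitaryGroup (Sector D p) ℂ) :
    Matrix.unitaryGroup (QubitBasis D) ℂ :=
  ⟨Matrix.blockDiagonal' fun p => (U p : Matrix (Sector D p) (Sector D p) ℂ), by
    rw [Matrix.mem_unitaryGroup_iff, Matrix.star_eq_conjTranspose,
      Matrix.blockDiagonal'_conjTranspose, ← Matrix.blockDiagonal'_mul]
    have h : (fun p => (U p : Matrix (Sector D p) (Sector D p) ℂ) *
        (U p : Matrix (Sector D p) (Sector D p) ℂ).conjTranspose) = 1 := by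
      funext p
      exact Matrix.mem_unitaryGroup_iff.mp (U p).2
    rw [h, Matrix.blockDiagonal'_one]⟩

theorem measurable_directSumUnitary (D : ℕ) : Measurable (directSumUnitary D) := by
  refine Continuous.measurable (Continuous.subtype_mk ?_ _)
  exact Continuous.matrix_blockDiagonal'
    (continuous_pi fun p => continuous_subtype_val.comp (continuous_apply p))

/-- The `U(1)`-symmetric Haar ensemble: the law of `⨁ₚ Uₚ`, where the blocks `Uₚ` are
independent and `Uₚ` is Haar distributed on the unitary group of the charge sector `p`. -/
noncomputable def symmetricHaar (D : ℕ) : Measure (Matrix.unitaryGroup (QubitBasis D) ℂ) :=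
  (Measure.pi fun p : Fin (D + 1) => haarUnitary (Sector D p)).map (directSumUnitary D)

instance symmetricHaarIsProbability (D : ℕ) : IsProbabilityMeasure (symmetricHaar D) :=
  Measure.isProbabilityMeasure_map (measurable_directSumUnitary D).aemeasurable

/-- The trace `Tr Uₚ` of the block of `U` in the charge sector `p`. -/
def sectorTrace {D : ℕ} (U : Matrix.unitaryGroup (QubitBasis D) ℂ) (p : Fin (D + 1)) : ℂ :=
  (Matrix.blockDiag' (U : Matrix (QubitBasis D) (QubitBasis D) ℂ) p).trace

/-- The contribution of `k` distinct charge sectors to the `2k`-point form factor. Expanding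
`|∑ₚ Tr Uₚ| ^ (2k)` gives the terms `∏ᵢ Tr U_{pᵢ} · conj (Tr U_{qᵢ})`; this is the sum of the
averages of those in which `p₁, …, pₖ` are distinct and `q` is a rearrangement of `p`. -/
noncomputable def distinctSectorPart (D k : ℕ) : ℂ :=
  ∑ p : Fin k ↪ Fin (D + 1), ∑ s : Equiv.Perm (Fin k),
    ∫ U, (∏ i, sectorTrace U (p i) * (starRingEnd ℂ) (sectorTrace U (p (s i)))) ∂(symmetricHaar D)

/-! The analytic input is the exact moment `E |Tr U|^(2m) = m!` on `U(N)` for `m ≤ N`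
(`formFactor_haarUnitary`). It is obtained without representation theory. Invariance of Haar measure
under `U ↦ exp(sX) U` gives loop equations for the mixed moments `E[p_σ(U) conj(Tr U)^m]`
(`cycleMoment_loop`). For `m ≤ N` the loop equations have a unique solution by a maximum principle,
namely `m!` at `σ = 1` and `0` elsewhere (`cycleMoment_eq`).

A sector with `0 < p < D` has dimension at least `D`, so for `k ≤ D` its trace has the moments `m!`,
`m ≤ k`, of a standard complex Gaussian; the two extreme sectors are one-dimensional, with all
moments `1 ≤ m!`. The traces are independent and phase invariant, so the moments of their sum obey a
recursion under which `s` Gaussian summands give `m! s^m`. Monotonicity of this recursion yields `k!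
(D-1)^k ≤ R_{2k} ≤ k! (D+1)^k`, while the contribution of distinct sectors is `k!` times the falling
factorial of `D+1` of length `k`. Bernoulli's inequality compares these quantities: shifting `D` by
a constant costs a relative error of order `k/D`, the falling factorial one of order `k²/D`. -/

/-! ### Integration by parts on the unitary group. -/

section Haar

variable {n : Type} [Fintype n] [DecidableEq n]

instance haarUnitaryIsMulLeftInvariant : (haarUnitary n).IsMulLeftInvariant := by
  unfold haarUnitary
  infer_instance

theorem continuous_unitary_entry (i j : n) :
    Continuous fun U : Matrix.unitaryGroup n ℂ => (U : Matrix n n ℂ) i j :=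
  continuous_subtype_val.matrix_elem i j

theorem continuous_unitary_trace :
    Continuous fun U : Matrix.unitaryGroup n ℂ => (U : Matrix n n ℂ).trace :=
  continuous_subtype_val.matrix_trace

theorem continuous_unitary_conj_trace :
    Continuous fun U : Matrix.unitaryGroup n ℂ => (starRingEnd ℂ) (U : Matrix n n ℂ).trace :=
  Complex.continuous_conj.comp continuous_unitary_trace

theorem continuous_unitary_prod_entry {ι : Type*} (s : Finset ι) (r c : ι → n) :
    Continuous fun U : Matrix.unitaryGroup n ℂ => ∏ a ∈ s, (U : Matrix n n ℂ) (r a) (c a) :=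
  continuous_finsetProd _ fun a _ => continuous_unitary_entry (r a) (c a)

theorem Continuous.integrable_haarUnitary {F : Matrix.unitaryGroup n ℂ → ℂ} (hF : Continuous F) :
    Integrable F (haarUnitary n) :=
  hF.integrable_of_hasCompactSupport (HasCompactSupport.of_compactSpace F)

/-- By left invariance `∫ F(γ s * U)` does not depend on `s`; differentiate under the integral at `s
= 0`, where compactness supplies the dominating constant. -/
theorem integral_haarUnitary_deriv_eq_zero {F F' : Matrix.unitaryGroup n ℂ → ℂ}
    (hF : Continuous F) (hF' : Continuous F') {γ : ℝ → Matrix.unitaryGroup n ℂ}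
    (h : ∀ U t, HasDerivAt (fun s => F (γ s * U)) (F' (γ t * U)) t) :
    ∫ U, F' U ∂(haarUnitary n) = 0 := by
  obtain ⟨C, hC⟩ : ∃ C, ∀ U, ‖F' U‖ ≤ C := by
    obtain ⟨C, hC⟩ := isCompact_univ.exists_bound_of_continuousOn hF'.continuousOn
    exact ⟨C, fun U => hC U trivial⟩
  have key := (hasDerivAt_integral_of_dominated_loc_of_deriv_le (μ := haarUnitary n)
    (F := fun s U => F (γ s * U)) (F' := fun s U => F' (γ s * U)) (x₀ := (0 : ℝ))
    (bound := fun _ => C) (s := Set.univ) Filter.univ_mem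
    (Filter.Eventually.of_forall fun s =>
      (hF.comp (continuous_const_mul (γ s))).integrable_haarUnitary.aestronglyMeasurable)
    (hF.comp (continuous_const_mul (γ 0))).integrable_haarUnitary
    (hF'.comp (continuous_const_mul (γ 0))).integrable_haarUnitary.aestronglyMeasurable
    (Filter.Eventually.of_forall fun U s _ => hC _) (integrable_const C)
    (Filter.Eventually.of_forall fun U s _ => h U s)).2
  simp only [integral_mul_left_eq_self] at key
  simpa using key.unique (hasDerivAt_const _ _)

-- The curve is `s ↦ exp(sX)`. Derivatives are taken entrywise, so the operator norm used for the
-- exponential stays inside this proof.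
open scoped Matrix.Norms.L2Operator in
theorem exists_unitary_curve {X : Matrix n n ℂ} (hX : X ∈ skewAdjoint (Matrix n n ℂ)) :
    ∃ γ : ℝ → Matrix.unitaryGroup n ℂ, ∀ (U : Matrix.unitaryGroup n ℂ) (i j : n) (t : ℝ),
      HasDerivAt (fun s => ((γ s * U : Matrix.unitaryGroup n ℂ) : Matrix n n ℂ) i j)
        ((X * ((γ t * U : Matrix.unitaryGroup n ℂ) : Matrix n n ℂ)) i j) t := by
  let : NormedAlgebra ℚ (Matrix n n ℂ) := .restrictScalars ℚ ℝ _
  refine ⟨fun s => ⟨NormedSpace.exp (s • X),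
    NormedSpace.exp_mem_unitary_of_mem_skewAdjoint (skewAdjoint.smul_mem s hX)⟩, ?_⟩
  intro U i j t
  have h := hasDerivAt_exp_smul_const' (𝕂 := ℝ) X t
  let ℓ : Matrix n n ℂ →ₗ[ℝ] ℂ :=
    (Matrix.entryLinearMap ℝ ℂ i j).comp (LinearMap.mulRight ℝ (U : Matrix n n ℂ))
  have h2 := (LinearMap.toContinuousLinearMap ℓ).hasFDerivAt.comp_hasDerivAt t h
  refine (h2.congr_deriv ?_ :)
  change (X * NormedSpace.exp (t • X) * (U : Matrix n n ℂ)) i j = _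
  rw [mul_assoc]
  rfl

/-- The complex-linear extension to all matrices `X` of the derivative along the flow of `X`
of `∏ a, U (r a) (c a) * conj (Tr U) ^ k`. -/
noncomputable def monomialDeriv {m : ℕ} (r c : Fin m → n) (k : ℕ) (U : Matrix.unitaryGroup n ℂ) :
    Matrix n n ℂ →ₗ[ℂ] ℂ :=
  (∑ a, ((∏ b ∈ Finset.univ.erase a, (U : Matrix n n ℂ) (r b) (c b)) *
      (starRingEnd ℂ) (U : Matrix n n ℂ).trace ^ k) •
      (Matrix.entryLinearMap ℂ ℂ (r a) (c a)).comp (LinearMap.mulRight ℂ (U : Matrix n n ℂ))) -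
    ((∏ b, (U : Matrix n n ℂ) (r b) (c b)) *
      (k * (starRingEnd ℂ) (U : Matrix n n ℂ).trace ^ (k - 1))) •
      (Matrix.traceLinearMap n ℂ ℂ).comp (LinearMap.mulLeft ℂ (star (U : Matrix n n ℂ)))

theorem monomialDeriv_apply {m : ℕ} (r c : Fin m → n) (k : ℕ) (U : Matrix.unitaryGroup n ℂ)
    (X : Matrix n n ℂ) : monomialDeriv r c k U X =
      (∑ a, ((∏ b ∈ Finset.univ.erase a, (U : Matrix n n ℂ) (r b) (c b)) *
        (starRingEnd ℂ) (U : Matrix n n ℂ).trace ^ k) * (X * (U : Matrix n n ℂ)) (r a) (c a)) -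
      ((∏ b, (U : Matrix n n ℂ) (r b) (c b)) *
        (k * (starRingEnd ℂ) (U : Matrix n n ℂ).trace ^ (k - 1))) *
          (star (U : Matrix n n ℂ) * X).trace := by
  simp [monomialDeriv, LinearMap.sum_apply]

theorem continuous_monomialDeriv {m : ℕ} (r c : Fin m → n) (k : ℕ) (X : Matrix n n ℂ) :
    Continuous fun U => monomialDeriv r c k U X := by
  simp only [monomialDeriv_apply]
  have h3 : Continuous fun U : Matrix.unitaryGroup n ℂ => (star (U : Matrix n n ℂ) * X).trace :=
    (continuous_subtype_val.star.mul continuous_const).matrix_trace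
  have h4 : ∀ i j, Continuous fun U : Matrix.unitaryGroup n ℂ => (X * (U : Matrix n n ℂ)) i j :=
    fun i j => (continuous_const.mul continuous_subtype_val).matrix_elem i j
  refine (continuous_finsetSum _ fun a _ => ?_).sub
    ((continuous_unitary_prod_entry _ r c).mul (continuous_const.mul
      (continuous_unitary_conj_trace.pow _)) |>.mul h3)
  exact ((continuous_unitary_prod_entry _ r c).mul (continuous_unitary_conj_trace.pow _)).mul
    (h4 _ _)

theorem integral_monomialDeriv_of_mem_skewAdjoint {m : ℕ} (r c : Fin m → n) (k : ℕ)
    {X : Matrix n n ℂ} (hX : X ∈ skewAdjoint (Matrix n n ℂ)) :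
    ∫ U, monomialDeriv r c k U X ∂(haarUnitary n) = 0 := by
  obtain ⟨γ, hγ⟩ := exists_unitary_curve hX
  refine integral_haarUnitary_deriv_eq_zero (γ := γ)
    (F := fun U => (∏ b, (U : Matrix n n ℂ) (r b) (c b)) *
      (starRingEnd ℂ) (U : Matrix n n ℂ).trace ^ k) ?_ (continuous_monomialDeriv r c k X) ?_
  · exact (continuous_unitary_prod_entry _ r c).mul (continuous_unitary_conj_trace.pow _)
  · intro U t
    have h1 := HasDerivAt.fun_finsetProd (u := Finset.univ)
      (fun a _ => hγ U (r a) (c a) t)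
    have h2 : HasDerivAt (fun s => (starRingEnd ℂ)
        ((γ s * U : Matrix.unitaryGroup n ℂ) : Matrix n n ℂ).trace)
        (-(star ((γ t * U : Matrix.unitaryGroup n ℂ) : Matrix n n ℂ) * X).trace) t := by
      have h3 : HasDerivAt (fun s => ((γ s * U : Matrix.unitaryGroup n ℂ) : Matrix n n ℂ).trace)
          (X * ((γ t * U : Matrix.unitaryGroup n ℂ) : Matrix n n ℂ)).trace t :=
        HasDerivAt.fun_sum fun i _ => hγ U i i t
      -- The derivative `conj(Tr(XU))` is antilinear in `X`; skew-adjointness rewrites it as `-Tr(U*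
      -- X)`, which extends complex-linearly.
      have h5 : star X = -X := hX
      have h6 := Matrix.trace_conjTranspose
        (X * ((γ t * U : Matrix.unitaryGroup n ℂ) : Matrix n n ℂ))
      rw [Matrix.conjTranspose_mul, ← Matrix.star_eq_conjTranspose X, h5, mul_neg,
        Matrix.trace_neg] at h6
      rw [Matrix.star_eq_conjTranspose, h6]
      exact h3.star
    have h5 := h1.mul (h2.pow k)
    refine h5.congr_deriv ?_
    rw [monomialDeriv_apply, Finset.sum_mul, sub_eq_add_neg]
    simp only [smul_eq_mul, Pi.pow_apply]
    congr 1
    · exact Finset.sum_congr rfl fun a _ => by ring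
    · ring

/-- Skew-adjoint matrices span all matrices over `ℂ` and the integrand is linear in `X`. This makes
matrix units, which generate no unitary flow, admissible. -/
theorem integral_monomialDeriv {m : ℕ} (r c : Fin m → n) (k : ℕ) (X : Matrix n n ℂ) :
    ∫ U, monomialDeriv r c k U X ∂(haarUnitary n) = 0 := by
  have hA : X - star X ∈ skewAdjoint (Matrix n n ℂ) := by
    simp [skewAdjoint.mem_iff]
  have hB : Complex.I • (X + star X) ∈ skewAdjoint (Matrix n n ℂ) := by
    simp [skewAdjoint.mem_iff, star_smul, add_comm]
  have hX : X = (1 / 2 : ℂ) • (X - star X) - (Complex.I / 2) • (Complex.I • (X + star X)) := by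
    rw [smul_smul, div_mul_eq_mul_div, Complex.I_mul_I]
    module
  have h : ∀ U, monomialDeriv r c k U X = (1 / 2 : ℂ) * monomialDeriv r c k U (X - star X) -
      (Complex.I / 2) * monomialDeriv r c k U (Complex.I • (X + star X)) := by
    intro U
    conv_lhs => rw [hX]
    rw [map_sub, map_smul, map_smul]
    rfl
  simp only [h]
  rw [integral_sub, integral_const_mul, integral_const_mul,
    integral_monomialDeriv_of_mem_skewAdjoint r c k hA,
    integral_monomialDeriv_of_mem_skewAdjoint r c k hB]
  · simp
  · exact (continuous_const.mul (continuous_monomialDeriv r c k _)).integrable_haarUnitary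
  · exact (continuous_const.mul (continuous_monomialDeriv r c k _)).integrable_haarUnitary

end Haar

/-! ### Loop equations and the moments of the trace. -/

section Loop

theorem update_update_eq_comp_swap {β : Type*} {m : ℕ} (i : Fin (m + 1) → β) (b : Fin m) :
    Function.update (Function.update i 0 (i b.succ)) b.succ (i 0) =
      i ∘ Equiv.swap 0 b.succ := by
  funext a
  rcases eq_or_ne a b.succ with rfl | hb
  · simp
  · rw [Function.update_of_ne hb]
    rcases eq_or_ne a 0 with rfl | h0
    · simp
    · simp [Function.update_of_ne h0, Equiv.swap_apply_of_ne_of_ne h0 hb]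

variable {n : Type} [Fintype n] [DecidableEq n]

/-- The mixed moment `E[∏ a, U (r a) (c a) * conj (Tr U) ^ k]`. -/
noncomputable def entryMoment {m : ℕ} (r c : Fin m → n) (k : ℕ) : ℂ :=
  ∫ U : Matrix.unitaryGroup n ℂ, (∏ a, (U : Matrix n n ℂ) (r a) (c a)) *
    (starRingEnd ℂ) (U : Matrix n n ℂ).trace ^ k ∂(haarUnitary n)

theorem integrable_entryMoment {m : ℕ} (r c : Fin m → n) (k : ℕ) :
    Integrable (fun U : Matrix.unitaryGroup n ℂ => (∏ a, (U : Matrix n n ℂ) (r a) (c a)) *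
      (starRingEnd ℂ) (U : Matrix n n ℂ).trace ^ k) (haarUnitary n) :=
  ((continuous_unitary_prod_entry _ r c).mul
    (continuous_unitary_conj_trace.pow k)).integrable_haarUnitary

/-- Integration by parts with `X = E_xy`: left multiplication by `E_xy` replaces a row index `x` by
`y`, and `Tr(U* E_xy) = conj(U x y)`. -/
theorem sum_entryMoment_update {m : ℕ} (r c : Fin m → n) (k : ℕ) (x y : n) :
    (∑ a, if r a = x then entryMoment (Function.update r a y) c k else 0) =
      k * ∫ U : Matrix.unitaryGroup n ℂ, (∏ a, (U : Matrix n n ℂ) (r a) (c a)) *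
        (starRingEnd ℂ) (U : Matrix n n ℂ).trace ^ (k - 1) *
          (starRingEnd ℂ) ((U : Matrix n n ℂ) x y) ∂(haarUnitary n) := by
  have h := integral_monomialDeriv r c k (Matrix.single x y 1)
  have hd : ∀ U : Matrix.unitaryGroup n ℂ, monomialDeriv r c k U (Matrix.single x y 1) =
      (∑ a, if r a = x then (∏ b, (U : Matrix n n ℂ) (Function.update r a y b) (c b)) *
        (starRingEnd ℂ) (U : Matrix n n ℂ).trace ^ k else 0) -
      k * ((∏ a, (U : Matrix n n ℂ) (r a) (c a)) *
        (starRingEnd ℂ) (U : Matrix n n ℂ).trace ^ (k - 1) *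
          (starRingEnd ℂ) ((U : Matrix n n ℂ) x y)) := by
    intro U
    rw [monomialDeriv_apply]
    congr 1
    · refine Finset.sum_congr rfl fun a _ => ?_
      split_ifs with hx
      · subst hx
        rw [Matrix.single_mul_apply_same, ← Finset.mul_prod_erase _ _ (Finset.mem_univ a),
          Function.update_self]
        have : ∏ b ∈ Finset.univ.erase a, (U : Matrix n n ℂ) (Function.update r a y b) (c b) =
            ∏ b ∈ Finset.univ.erase a, (U : Matrix n n ℂ) (r b) (c b) :=
          Finset.prod_congr rfl fun b hb => by
            rw [Function.update_of_ne (Finset.ne_of_mem_erase hb)]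
        rw [this]
        ring
      · rw [Matrix.single_mul_apply_of_ne _ _ _ _ _ hx, mul_zero]
    · rw [Matrix.trace_mul_single, Matrix.star_apply]
      simp only [MulOpposite.op_one, one_smul]
      rw [starRingEnd_apply, starRingEnd_apply]
      ring
  simp only [hd] at h
  rw [integral_sub, integral_finsetSum, integral_const_mul, sub_eq_zero] at h
  · rw [← h]
    refine Finset.sum_congr rfl fun a _ => ?_
    split_ifs
    · rfl
    · simp
  · intro a _
    split_ifs
    · exact integrable_entryMoment _ _ _
    · exact integrable_zero _ _ _
  · refine integrable_finsetSum _ fun a _ => ?_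
    split_ifs
    · exact integrable_entryMoment _ _ _
    · exact integrable_zero _ _ _
  · exact (continuous_const.mul (((continuous_unitary_prod_entry _ r c).mul
      (continuous_unitary_conj_trace.pow _)).mul
        (Complex.continuous_conj.comp (continuous_unitary_entry x y)))).integrable_haarUnitary

/-- The moment `E[p_σ(U) * conj (Tr U) ^ m]`, where `p_σ(U)` is the product of the traces
`Tr (U ^ l)` over the cycle lengths `l` of `σ`. -/
noncomputable def cycleMoment (n : Type) [Fintype n] [DecidableEq n] {m : ℕ}
    (σ : Equiv.Perm (Fin m)) : ℂ :=
  ∑ i : Fin m → n, entryMoment i (i ∘ σ) m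

theorem entryMoment_comp_perm {m : ℕ} (r c : Fin m → n) (τ : Equiv.Perm (Fin m)) (k : ℕ) :
    entryMoment (r ∘ τ) (c ∘ τ) k = entryMoment r c k := by
  unfold entryMoment
  congr 1 with U
  rw [← Equiv.prod_comp τ fun a => (U : Matrix n n ℂ) (r a) (c a)]
  rfl

/-- On the right, the term `a = 0` restores `i` for every `x`, whence the factor `N`. The term `a =
b.succ` forces `x = i b.succ` and exchanges two row indices, which amounts to multiplying `σ` by a
transposition. -/
theorem sum_entryMoment_row {m : ℕ} (i : Fin (m + 1) → n) (σ : Equiv.Perm (Fin (m + 1))) (k : ℕ) :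
    (Fintype.card n : ℂ) * entryMoment i (i ∘ σ) k +
        ∑ b : Fin m, entryMoment i (i ∘ ⇑(σ * Equiv.swap 0 b.succ)) k =
      ∑ x, ∑ a, if Function.update i 0 x a = x then
        entryMoment (Function.update (Function.update i 0 x) a (i 0)) (i ∘ σ) k else 0 := by
  simp only [Fin.sum_univ_succ, Function.update_self, if_true, Function.update_idem,
    Function.update_eq_self, Finset.sum_add_distrib, Finset.sum_const, Finset.card_univ,
    nsmul_eq_mul]
  congr 1
  rw [Finset.sum_comm]
  refine Finset.sum_congr rfl fun b _ => ?_
  simp only [Function.update_of_ne (Fin.succ_ne_zero b), Finset.sum_ite_eq, Finset.mem_univ,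
    if_true, update_update_eq_comp_swap]
  rw [← entryMoment_comp_perm _ _ (Equiv.swap 0 b.succ)]
  congr 1
  funext a
  simp

/-- Orthonormality of the columns of `U`, applied to the sum over `x`, removes the factor at
position `0`. -/
theorem sum_integral_row {m : ℕ} (i : Fin (m + 1) → n) (σ : Equiv.Perm (Fin (m + 1))) (k : ℕ) :
    ∑ x, ∫ U : Matrix.unitaryGroup n ℂ,
        (∏ a, (U : Matrix n n ℂ) (Function.update i 0 x a) ((i ∘ σ) a)) *
        (starRingEnd ℂ) (U : Matrix n n ℂ).trace ^ k *
          (starRingEnd ℂ) ((U : Matrix n n ℂ) x (i 0)) ∂(haarUnitary n) =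
      if i 0 = i (σ 0) then
        entryMoment (fun a : Fin m => i a.succ) (fun a : Fin m => i (σ a.succ)) k else 0 := by
  rw [← integral_finsetSum]
  · have h : ∀ U : Matrix.unitaryGroup n ℂ, (∑ x,
        (∏ a, (U : Matrix n n ℂ) (Function.update i 0 x a) ((i ∘ σ) a)) *
        (starRingEnd ℂ) (U : Matrix n n ℂ).trace ^ k *
          (starRingEnd ℂ) ((U : Matrix n n ℂ) x (i 0))) = if i 0 = i (σ 0) then
        (∏ a : Fin m, (U : Matrix n n ℂ) (i a.succ) (i (σ a.succ))) *
        (starRingEnd ℂ) (U : Matrix n n ℂ).trace ^ k else 0 := by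
      intro U
      have hU : ∑ x, (starRingEnd ℂ) ((U : Matrix n n ℂ) x (i 0)) *
          (U : Matrix n n ℂ) x (i (σ 0)) = if i 0 = i (σ 0) then 1 else 0 := by
        have := congrFun (congrFun (Matrix.mem_unitaryGroup_iff'.mp U.2) (i 0)) (i (σ 0))
        rwa [Matrix.mul_apply, Matrix.one_apply] at this
      rw [← mul_boole, ← hU, Finset.mul_sum]
      refine Finset.sum_congr rfl fun x _ => ?_
      simp only [Fin.prod_univ_succ, Function.update_self, Function.comp_apply,
        Function.update_of_ne (Fin.succ_ne_zero _)]
      ring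
    simp only [h]
    split_ifs
    · rfl
    · simp
  · intro x _
    exact (((continuous_unitary_prod_entry _ _ _).mul
      (continuous_unitary_conj_trace.pow _)).mul
        (Complex.continuous_conj.comp (continuous_unitary_entry x (i 0)))).integrable_haarUnitary

/-- Here `p` is the image of `0`, and `e` is the permutation with `0` cut out of its cycle. If `0`
is fixed its index is summed freely and gives `N`; otherwise the delta ties it to another index. The
factor `m + 1` comes from differentiating `conj(Tr U)^(m+1)`. -/
theorem cycleMoment_loop {m : ℕ} (p : Fin (m + 1)) (e : Equiv.Perm (Fin m)) :
    (Fintype.card n : ℂ) * cycleMoment n (Equiv.Perm.decomposeFin.symm (p, e)) +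
        ∑ b : Fin m, cycleMoment n (Equiv.Perm.decomposeFin.symm (p, e) * Equiv.swap 0 b.succ) =
      (m + 1) * ((if p = 0 then (Fintype.card n : ℂ) else 1) * cycleMoment n e) := by
  set σ := Equiv.Perm.decomposeFin.symm (p, e) with hσ
  have h1 : ∀ i : Fin (m + 1) → n, (Fintype.card n : ℂ) * entryMoment i (i ∘ σ) (m + 1) +
        ∑ b : Fin m, entryMoment i (i ∘ ⇑(σ * Equiv.swap 0 b.succ)) (m + 1) =
      (m + 1) * if i 0 = i (σ 0) then
        entryMoment (fun a : Fin m => i a.succ) (fun a : Fin m => i (σ a.succ)) m else 0 := by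
    intro i
    rw [sum_entryMoment_row, ← sum_integral_row, Finset.mul_sum]
    refine Finset.sum_congr rfl fun x _ => ?_
    rw [sum_entryMoment_update]
    simp
  have h2 := Finset.sum_congr (rfl : (Finset.univ : Finset (Fin (m + 1) → n)) = _)
    fun i _ => h1 i
  rw [Finset.sum_add_distrib, ← Finset.mul_sum, Finset.sum_comm, ← Finset.mul_sum] at h2
  refine h2.trans ?_
  congr 1
  rw [← Equiv.sum_comp (Fin.consEquiv fun _ => n), Fintype.sum_prod_type, Finset.sum_comm,
    cycleMoment, Finset.mul_sum]
  refine Finset.sum_congr rfl fun j _ => ?_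
  have h3 : ∀ z : n, (if (Fin.cons z j : Fin (m + 1) → n) 0 = (Fin.cons z j : Fin (m + 1) → n) (σ 0)
      then entryMoment (fun a : Fin m => (Fin.cons z j : Fin (m + 1) → n) a.succ)
        (fun a : Fin m => (Fin.cons z j : Fin (m + 1) → n) (σ a.succ)) m else 0) =
      if z = (Fin.cons z j : Fin (m + 1) → n) p then entryMoment j (j ∘ e) m else 0 := by
    intro z
    rw [hσ, Equiv.Perm.decomposeFin_symm_apply_zero, Fin.cons_zero]
    refine ite_congr rfl (fun hz => ?_) fun _ => rfl
    congr 1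
    funext a
    rw [Equiv.Perm.decomposeFin_symm_apply_succ]
    rcases eq_or_ne (e a).succ p with h | h
    · rw [h, Equiv.swap_apply_right, Fin.cons_zero, hz, ← h]
      rfl
    · rw [Equiv.swap_apply_of_ne_of_ne (Fin.succ_ne_zero _) h]
      rfl
  refine (Finset.sum_congr rfl fun z _ => h3 z).trans ?_
  refine Fin.cases ?_ (fun q => ?_) p
  · simp
  · simp

/-- The claimed values solve the same loop equation, so the error `ψ` solves the homogeneous one,
with `m` terms on the right. Where `‖ψ‖` is maximal this gives `N ‖ψ‖ ≤ m ‖ψ‖`, and `N ≥ m + 1`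
forces `ψ = 0`. -/
theorem cycleMoment_eq {m : ℕ} (hm : m ≤ Fintype.card n) (σ : Equiv.Perm (Fin m)) :
    cycleMoment n σ = if σ = 1 then (m.factorial : ℂ) else 0 := by
  induction m with
  | zero =>
    rw [if_pos (Subsingleton.elim _ _)]
    simp [cycleMoment, entryMoment]
  | succ m ih =>
    let ψ : Equiv.Perm (Fin (m + 1)) → ℂ := fun σ =>
      cycleMoment n σ - if σ = 1 then ((m + 1).factorial : ℂ) else 0
    have hψ : ∀ σ, (Fintype.card n : ℂ) * ψ σ = -∑ b : Fin m, ψ (σ * Equiv.swap 0 b.succ) := by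
      intro σ
      obtain ⟨⟨p, e⟩, rfl⟩ := Equiv.Perm.decomposeFin.symm.surjective σ
      have h1 := cycleMoment_loop (n := n) p e
      rw [ih (by omega)] at h1
      have h2 : (Fintype.card n : ℂ) *
            (if Equiv.Perm.decomposeFin.symm (p, e) = 1 then ((m + 1).factorial : ℂ) else 0) +
          ∑ b : Fin m, (if Equiv.Perm.decomposeFin.symm (p, e) * Equiv.swap 0 b.succ = 1
            then ((m + 1).factorial : ℂ) else 0) =
          (m + 1) * ((if p = 0 then (Fintype.card n : ℂ) else 1) *
            if e = 1 then (m.factorial : ℂ) else 0) := by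
        have hone : Equiv.Perm.decomposeFin.symm (0, (1 : Equiv.Perm (Fin m))) = 1 := by
          ext a
          refine Fin.cases ?_ (fun q => ?_) a <;> simp
        have hswap : ∀ q : Fin (m + 1),
            Equiv.Perm.decomposeFin.symm (q, (1 : Equiv.Perm (Fin m))) = Equiv.swap 0 q := by
          intro q
          ext a
          refine Fin.cases ?_ (fun q => ?_) a <;> simp
        -- The transposition sum sees the identity only when the permutation is itself that
        -- transposition, that is, for at most one `b`.
        have hs : ∀ b : Fin m, Equiv.Perm.decomposeFin.symm (p, e) * Equiv.swap 0 b.succ = 1 ↔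
            p = b.succ ∧ e = 1 := by
          intro b
          rw [mul_eq_one_iff_eq_inv, Equiv.swap_inv, ← hswap, Equiv.apply_eq_iff_eq, Prod.mk.injEq]
        have ho : Equiv.Perm.decomposeFin.symm (p, e) = 1 ↔ p = 0 ∧ e = 1 := by
          rw [← hone, Equiv.apply_eq_iff_eq, Prod.mk.injEq]
        simp only [hs, ho, Nat.factorial_succ]
        by_cases he : e = 1
        · simp only [he, and_true, if_true]
          refine Fin.cases ?_ (fun q => ?_) p
          · simp [fun b : Fin m => (Fin.succ_ne_zero b).symm]
            ring
          · simp [Fin.succ_inj]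
        · simp [he]
      simp only [ψ, Finset.sum_sub_distrib]
      linear_combination h1 - h2
    obtain ⟨τ, -, hτ⟩ := Finset.exists_max_image Finset.univ (fun σ => ‖ψ σ‖) ⟨1, Finset.mem_univ _⟩
    have h1 : (Fintype.card n : ℝ) * ‖ψ τ‖ ≤ m * ‖ψ τ‖ := by
      calc (Fintype.card n : ℝ) * ‖ψ τ‖ = ‖(Fintype.card n : ℂ) * ψ τ‖ := by simp
        _ = ‖∑ b : Fin m, ψ (τ * Equiv.swap 0 b.succ)‖ := by rw [hψ, norm_neg]
        _ ≤ ∑ b : Fin m, ‖ψ (τ * Equiv.swap 0 b.succ)‖ := norm_sum_le _ _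
        _ ≤ ∑ b : Fin m, ‖ψ τ‖ := Finset.sum_le_sum fun b _ => hτ _ (Finset.mem_univ _)
        _ = m * ‖ψ τ‖ := by simp
    have h2 : ((m + 1 : ℕ) : ℝ) ≤ Fintype.card n := by exact_mod_cast hm
    push_cast at h2
    have h3 : ‖ψ τ‖ = 0 := by nlinarith [norm_nonneg (ψ τ)]
    have h4 : ψ σ = 0 := by
      rw [← norm_eq_zero]
      exact le_antisymm (h3 ▸ hτ σ (Finset.mem_univ _)) (norm_nonneg _)
    exact sub_eq_zero.mp h4

theorem formFactor_haarUnitary {m : ℕ} (hm : m ≤ Fintype.card n) :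
    formFactor (haarUnitary n) m = m.factorial := by
  have h := cycleMoment_eq hm (1 : Equiv.Perm (Fin m))
  rw [if_pos rfl, cycleMoment] at h
  simp only [entryMoment] at h
  rw [← integral_finsetSum _ fun i _ => integrable_entryMoment _ _ _] at h
  rw [← Complex.ofReal_inj, formFactor, ← integral_complex_ofReal, Complex.ofReal_natCast, ← h]
  congr 1 with U
  rw [← Finset.sum_mul, Complex.ofReal_pow, pow_mul, ← Complex.mul_conj', mul_pow]
  congr 1
  rw [Matrix.trace, Fintype.sum_pow]
  rfl

end Loop

/-! ### Moments of sums of independent, phase-invariant variables. -/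

section Independent

open ProbabilityTheory

variable {Ω : Type*} [MeasurableSpace Ω] {μ : Measure Ω} [IsProbabilityMeasure μ]

/-- In the double binomial expansion, independence factors each term and the phase condition on `Y`
alone kills the off-diagonal ones. -/
theorem integral_norm_add_pow {X Y : Ω → ℂ} (hX : Measurable X) (hY : Measurable Y)
    {A B : ℝ} (hA : ∀ ω, ‖X ω‖ ≤ A) (hB : ∀ ω, ‖Y ω‖ ≤ B) (hXY : IndepFun X Y μ)
    (hphase : ∀ a b : ℕ, a ≠ b → ∫ ω, Y ω ^ a * (starRingEnd ℂ) (Y ω) ^ b ∂μ = 0) (m : ℕ) :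
    ∫ ω, ‖X ω + Y ω‖ ^ (2 * m) ∂μ = ∑ a ∈ Finset.range (m + 1), (m.choose a : ℝ) ^ 2 *
      ((∫ ω, ‖X ω‖ ^ (2 * a) ∂μ) * ∫ ω, ‖Y ω‖ ^ (2 * (m - a)) ∂μ) := by
  have hnorm : ∀ (z : ℂ) (l : ℕ), ((‖z‖ ^ (2 * l) : ℝ) : ℂ) = z ^ l * (starRingEnd ℂ) z ^ l := by
    intro z l
    rw [Complex.ofReal_pow, pow_mul, ← Complex.mul_conj', mul_pow]
  have hφ : ∀ a b : ℕ, Measurable fun z : ℂ => z ^ a * (starRingEnd ℂ) z ^ b := fun a b =>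
    ((continuous_id.pow a).mul (Complex.continuous_conj.pow b)).measurable
  have hbound : ∀ {Z : Ω → ℂ} {C : ℝ}, (∀ ω, ‖Z ω‖ ≤ C) → ∀ (a b : ℕ) (ω : Ω),
      ‖Z ω ^ a * (starRingEnd ℂ) (Z ω) ^ b‖ ≤ C ^ a * C ^ b := by
    intro Z C hC a b ω
    have h0 : 0 ≤ C := (norm_nonneg _).trans (hC ω)
    rw [norm_mul, norm_pow, norm_pow, RCLike.norm_conj]
    gcongr <;> exact hC ω
  have hint : ∀ a b c d : ℕ, Integrable (fun ω => (X ω ^ a * (starRingEnd ℂ) (X ω) ^ b) *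
      (Y ω ^ c * (starRingEnd ℂ) (Y ω) ^ d)) μ := by
    intro a b c d
    refine Integrable.of_bound (((hφ a b).comp hX).mul ((hφ c d).comp hY)).aestronglyMeasurable
      ((A ^ a * A ^ b) * (B ^ c * B ^ d)) (Filter.Eventually.of_forall fun ω => ?_)
    rw [norm_mul]
    exact mul_le_mul (hbound hA a b ω) (hbound hB c d ω) (norm_nonneg _)
      ((norm_nonneg _).trans (hbound hA a b ω))
  have hexp : ∀ ω, ((‖X ω + Y ω‖ ^ (2 * m) : ℝ) : ℂ) = ∑ a ∈ Finset.range (m + 1),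
      ∑ b ∈ Finset.range (m + 1), ((m.choose a : ℂ) * m.choose b) *
        ((X ω ^ a * (starRingEnd ℂ) (X ω) ^ b) *
          (Y ω ^ (m - a) * (starRingEnd ℂ) (Y ω) ^ (m - b))) := by
    intro ω
    rw [hnorm, map_add, add_pow, add_pow, Finset.sum_mul_sum]
    refine Finset.sum_congr rfl fun a _ => Finset.sum_congr rfl fun b _ => ?_
    ring
  rw [← Complex.ofReal_inj, ← integral_complex_ofReal]
  simp only [hexp]
  rw [integral_finsetSum _ fun a _ => integrable_finsetSum _ fun b _ => (hint _ _ _ _).const_mul _]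
  push_cast
  refine Finset.sum_congr rfl fun a ha => ?_
  rw [integral_finsetSum _ fun b _ => (hint _ _ _ _).const_mul _]
  have hmul : ∀ b, ∫ ω, (X ω ^ a * (starRingEnd ℂ) (X ω) ^ b) *
      (Y ω ^ (m - a) * (starRingEnd ℂ) (Y ω) ^ (m - b)) ∂μ =
      (∫ ω, X ω ^ a * (starRingEnd ℂ) (X ω) ^ b ∂μ) *
        ∫ ω, Y ω ^ (m - a) * (starRingEnd ℂ) (Y ω) ^ (m - b) ∂μ := fun b =>
    (hXY.comp (hφ a b) (hφ (m - a) (m - b))).integral_fun_mul_eq_mul_integral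
      ((hφ a b).comp hX).aestronglyMeasurable ((hφ _ _).comp hY).aestronglyMeasurable
  rw [Finset.sum_eq_single_of_mem a ha]
  · rw [integral_const_mul, hmul, ← integral_complex_ofReal, ← integral_complex_ofReal]
    simp only [hnorm, sq]
  · intro b hb hab
    rw [Finset.mem_range] at ha hb
    rw [integral_const_mul, hmul, hphase _ _ (by omega), mul_zero, mul_zero]

/-- The inductive step for Gaussian-type moments: adding a summand with moments `m!` to one with
moments `m! s^m` replaces `s` by `s + 1`. -/
theorem sum_choose_sq_mul_factorial (s : ℝ) (m : ℕ) :
    ∑ a ∈ Finset.range (m + 1), (m.choose a : ℝ) ^ 2 *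
      ((a.factorial * s ^ a) * (m - a).factorial) = m.factorial * (s + 1) ^ m := by
  rw [add_pow, Finset.mul_sum]
  refine Finset.sum_congr rfl fun a ha => ?_
  have h : (m.choose a : ℝ) * a.factorial * (m - a).factorial = m.factorial := by
    exact_mod_cast Nat.choose_mul_factorial_mul_factorial (Finset.mem_range_succ_iff.mp ha)
  rw [← h]
  ring

variable {ι : Type*} [DecidableEq ι] {X : ι → Ω → ℂ}

theorem integral_norm_insert_sum_pow (hX : ∀ i, Measurable (X i)) {C : ι → ℝ}
    (hC : ∀ i ω, ‖X i ω‖ ≤ C i) (hindep : iIndepFun X μ)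
    (hphase : ∀ i, ∀ a b : ℕ, a ≠ b → ∫ ω, X i ω ^ a * (starRingEnd ℂ) (X i ω) ^ b ∂μ = 0)
    {s : Finset ι} {i : ι} (hi : i ∉ s) (m : ℕ) :
    ∫ ω, ‖∑ j ∈ insert i s, X j ω‖ ^ (2 * m) ∂μ =
      ∑ a ∈ Finset.range (m + 1), (m.choose a : ℝ) ^ 2 *
        ((∫ ω, ‖∑ j ∈ s, X j ω‖ ^ (2 * a) ∂μ) * ∫ ω, ‖X i ω‖ ^ (2 * (m - a)) ∂μ) := by
  have h := hindep.indepFun_finsetSum_of_notMem hX hi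
  rw [Finset.sum_fn] at h
  rw [← integral_norm_add_pow (Finset.measurable_sum s fun j _ => hX j) (hX i)
    (fun ω => norm_sum_le_of_le s fun j _ => hC j ω) (hC i) h (hphase i)]
  congr 1 with ω
  rw [Finset.sum_insert hi, add_comm]

theorem integral_norm_sum_pow_le (hX : ∀ i, Measurable (X i)) {C : ι → ℝ}
    (hC : ∀ i ω, ‖X i ω‖ ≤ C i) (hindep : iIndepFun X μ)
    (hphase : ∀ i, ∀ a b : ℕ, a ≠ b → ∫ ω, X i ω ^ a * (starRingEnd ℂ) (X i ω) ^ b ∂μ = 0)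
    {k : ℕ} (hk : ∀ i, ∀ m ≤ k, ∫ ω, ‖X i ω‖ ^ (2 * m) ∂μ ≤ m.factorial) (s : Finset ι) :
    ∀ m ≤ k, ∫ ω, ‖∑ j ∈ s, X j ω‖ ^ (2 * m) ∂μ ≤ m.factorial * (s.card : ℝ) ^ m := by
  induction s using Finset.induction_on with
  | empty =>
    intro m _
    rcases m with _ | m <;> simp
  | insert i s hi ih =>
    intro m hm
    rw [integral_norm_insert_sum_pow hX hC hindep hphase hi, Finset.card_insert_of_notMem hi,
      Nat.cast_succ, ← sum_choose_sq_mul_factorial]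
    refine Finset.sum_le_sum fun a ha => ?_
    rw [Finset.mem_range] at ha
    refine mul_le_mul_of_nonneg_left ?_ (by positivity)
    exact mul_le_mul (ih a (by omega)) (hk i _ (by omega))
      (integral_nonneg fun ω => by positivity) (by positivity)

/-- A summand outside `t` cannot lower the moment: the term `a = m` of the recursion is the old
moment and the others are nonnegative. -/
theorem le_integral_norm_sum_pow (hX : ∀ i, Measurable (X i)) {C : ι → ℝ}
    (hC : ∀ i ω, ‖X i ω‖ ≤ C i) (hindep : iIndepFun X μ)
    (hphase : ∀ i, ∀ a b : ℕ, a ≠ b → ∫ ω, X i ω ^ a * (starRingEnd ℂ) (X i ω) ^ b ∂μ = 0)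
    {k : ℕ} {t : Finset ι}
    (hk : ∀ i ∈ t, ∀ m ≤ k, (m.factorial : ℝ) ≤ ∫ ω, ‖X i ω‖ ^ (2 * m) ∂μ) (s : Finset ι) :
    ∀ m ≤ k, m.factorial * ((s ∩ t).card : ℝ) ^ m ≤ ∫ ω, ‖∑ j ∈ s, X j ω‖ ^ (2 * m) ∂μ := by
  induction s using Finset.induction_on with
  | empty =>
    intro m _
    rcases m with _ | m <;> simp
  | insert i s hi ih =>
    intro m hm
    rw [integral_norm_insert_sum_pow hX hC hindep hphase hi]
    by_cases hit : i ∈ t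
    · rw [Finset.insert_inter_of_mem hit, Finset.card_insert_of_notMem (by simp [hi]),
        Nat.cast_succ, ← sum_choose_sq_mul_factorial]
      refine Finset.sum_le_sum fun a ha => ?_
      rw [Finset.mem_range] at ha
      refine mul_le_mul_of_nonneg_left ?_ (by positivity)
      exact mul_le_mul (ih a (by omega)) (hk i hit _ (by omega)) (by positivity)
        (integral_nonneg fun ω => by positivity)
    · rw [Finset.insert_inter_of_notMem hit]
      refine (ih m hm).trans (le_trans (le_of_eq ?_) (Finset.single_le_sum
        (f := fun a => (m.choose a : ℝ) ^ 2 * ((∫ ω, ‖∑ j ∈ s, X j ω‖ ^ (2 * a) ∂μ) *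
          ∫ ω, ‖X i ω‖ ^ (2 * (m - a)) ∂μ)) (fun a _ => ?_) (Finset.self_mem_range_succ m)))
      · simp
      · exact mul_nonneg (by positivity) (mul_nonneg (integral_nonneg fun ω => by positivity)
          (integral_nonneg fun ω => by positivity))

end Independent

/-! ### Charge sectors of the symmetric ensemble. -/

section Sectors

theorem integral_trace_pow_mul_conj_trace_pow {n : Type} [Fintype n] [DecidableEq n] {a b : ℕ}
    (hab : a ≠ b) : ∫ U : Matrix.unitaryGroup n ℂ, (U : Matrix n n ℂ).trace ^ a *
      (starRingEnd ℂ) (U : Matrix n n ℂ).trace ^ b ∂(haarUnitary n) = 0 := by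
  -- With `c = exp(iπ/(a-b))`, translating by the scalar unitary `c` negates the integrand.
  obtain ⟨c, hc, hcab⟩ : ∃ c : ℂ, c * (starRingEnd ℂ) c = 1 ∧
      c ^ a * (starRingEnd ℂ) c ^ b = -1 := by
    have h0 : (a : ℂ) - b ≠ 0 := sub_ne_zero.mpr (by exact_mod_cast hab)
    have hconj : (starRingEnd ℂ) (Complex.exp (Real.pi * Complex.I / (a - b))) =
        Complex.exp (-(Real.pi * Complex.I / (a - b))) := by
      rw [← Complex.exp_conj]
      simp [neg_div]
    refine ⟨Complex.exp (Real.pi * Complex.I / (a - b)), ?_, ?_⟩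
    · rw [hconj, ← Complex.exp_add, add_neg_cancel, Complex.exp_zero]
    · rw [hconj, ← Complex.exp_nat_mul, ← Complex.exp_nat_mul, ← Complex.exp_add,
        ← Complex.exp_pi_mul_I]
      congr 1
      field_simp
      ring
  let V : Matrix.unitaryGroup n ℂ := ⟨c • 1, by
    rw [Matrix.mem_unitaryGroup_iff, star_smul, star_one, smul_mul_smul_comm, mul_one]
    rw [starRingEnd_apply] at hc
    rw [hc, one_smul]⟩
  have h := integral_mul_left_eq_self (μ := haarUnitary n)
    (fun U : Matrix.unitaryGroup n ℂ => (U : Matrix n n ℂ).trace ^ a *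
      (starRingEnd ℂ) (U : Matrix n n ℂ).trace ^ b) V
  have hV : ∀ U : Matrix.unitaryGroup n ℂ,
      ((V * U : Matrix.unitaryGroup n ℂ) : Matrix n n ℂ).trace ^ a *
        (starRingEnd ℂ) ((V * U : Matrix.unitaryGroup n ℂ) : Matrix n n ℂ).trace ^ b =
      -((U : Matrix n n ℂ).trace ^ a * (starRingEnd ℂ) (U : Matrix n n ℂ).trace ^ b) := by
    intro U
    have : ((V * U : Matrix.unitaryGroup n ℂ) : Matrix n n ℂ) = c • (U : Matrix n n ℂ) := by
      simp [V]
    rw [this, Matrix.trace_smul, smul_eq_mul, map_mul, mul_pow, mul_pow]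
    linear_combination ((U : Matrix n n ℂ).trace ^ a *
      (starRingEnd ℂ) (U : Matrix n n ℂ).trace ^ b) * hcab
  simp only [hV] at h
  rw [integral_neg] at h
  linear_combination (-1 / 2 : ℂ) * h

theorem norm_unitary_trace_le {n : Type} [Fintype n] [DecidableEq n]
    (U : Matrix.unitaryGroup n ℂ) : ‖(U : Matrix n n ℂ).trace‖ ≤ Fintype.card n := by
  refine (norm_sum_le_of_le _ fun i _ => entry_norm_bound_of_unitary U.2 i i).trans ?_
  simp

theorem formFactor_haarUnitary_of_card_eq_one {n : Type} [Fintype n] [DecidableEq n]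
    (hn : Fintype.card n = 1) (k : ℕ) : formFactor (haarUnitary n) k = 1 := by
  obtain ⟨i, hi⟩ := Fintype.card_eq_one_iff.mp hn
  have : Unique n := ⟨⟨i⟩, hi⟩
  have h : ∀ U : Matrix.unitaryGroup n ℂ, ‖(U : Matrix n n ℂ).trace‖ = 1 := by
    intro U
    have h1 := congrFun (congrFun (Matrix.mem_unitaryGroup_iff'.mp U.2) default) default
    rw [Matrix.mul_apply, Matrix.one_apply_eq, Fintype.sum_unique, Matrix.star_apply] at h1
    have h2 : ‖(U : Matrix n n ℂ) default default‖ ^ 2 = 1 := by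
      have := congrArg norm h1
      rwa [norm_mul, norm_star, norm_one, ← sq] at this
    rw [Matrix.trace, Fintype.sum_unique, Matrix.diag_apply]
    exact (pow_eq_one_iff_of_nonneg (norm_nonneg _) two_ne_zero).mp h2
  simp [formFactor, h]

variable (D : ℕ)

/-- The independent Haar blocks of the `U(1)`-symmetric Haar ensemble. -/
noncomputable abbrev sectorHaar : Measure (∀ p : Fin (D + 1), Matrix.unitaryGroup (Sector D p) ℂ) :=
  Measure.pi fun p => haarUnitary (Sector D p)

variable {D}

theorem sectorTrace_directSumUnitary (U : ∀ p : Fin (D + 1), Matrix.unitaryGroup (Sector D p) ℂ)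
    (p : Fin (D + 1)) : sectorTrace (directSumUnitary D U) p =
      (U p : Matrix (Sector D p) (Sector D p) ℂ).trace := by
  rw [sectorTrace, directSumUnitary, Matrix.blockDiag'_blockDiagonal']

theorem trace_directSumUnitary (U : ∀ p : Fin (D + 1), Matrix.unitaryGroup (Sector D p) ℂ) :
    (directSumUnitary D U : Matrix (QubitBasis D) (QubitBasis D) ℂ).trace =
      ∑ p, (U p : Matrix (Sector D p) (Sector D p) ℂ).trace := by
  rw [directSumUnitary, Matrix.trace_blockDiagonal']

theorem measurable_sector_trace (p : Fin (D + 1)) :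
    Measurable fun U : ∀ p : Fin (D + 1), Matrix.unitaryGroup (Sector D p) ℂ =>
      (U p : Matrix (Sector D p) (Sector D p) ℂ).trace :=
  continuous_unitary_trace.measurable.comp (measurable_pi_apply p)

theorem iIndepFun_sector_trace : ProbabilityTheory.iIndepFun
    (fun (p : Fin (D + 1)) (U : ∀ p : Fin (D + 1), Matrix.unitaryGroup (Sector D p) ℂ) =>
      (U p : Matrix (Sector D p) (Sector D p) ℂ).trace) (sectorHaar D) :=
  ProbabilityTheory.iIndepFun_pi
    (X := fun p (V : Matrix.unitaryGroup (Sector D p) ℂ) =>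
      (V : Matrix (Sector D p) (Sector D p) ℂ).trace)
    fun _ => continuous_unitary_trace.measurable.aemeasurable

theorem integral_sectorHaar_eval {E : Type*} [NormedAddCommGroup E] [NormedSpace ℝ E]
    (p : Fin (D + 1)) {f : Matrix.unitaryGroup (Sector D p) ℂ → E} (hf : StronglyMeasurable f) :
    ∫ U, f (U p) ∂(sectorHaar D) = ∫ V, f V ∂(haarUnitary (Sector D p)) := by
  have h := measurePreserving_eval (fun p : Fin (D + 1) => haarUnitary (Sector D p)) p
  rw [← h.map_eq, integral_map h.measurable.aemeasurable hf.aestronglyMeasurable]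

theorem integral_norm_sector_trace_pow (p : Fin (D + 1)) (m : ℕ) :
    ∫ U, ‖(U p : Matrix (Sector D p) (Sector D p) ℂ).trace‖ ^ (2 * m) ∂(sectorHaar D) =
      formFactor (haarUnitary (Sector D p)) m :=
  integral_sectorHaar_eval p
    (f := fun V => ‖(V : Matrix (Sector D p) (Sector D p) ℂ).trace‖ ^ (2 * m))
    (continuous_unitary_trace.norm.pow _).measurable.stronglyMeasurable

theorem formFactor_symmetricHaar (k : ℕ) : formFactor (symmetricHaar D) k =
    ∫ U, ‖∑ p, (U p : Matrix (Sector D p) (Sector D p) ℂ).trace‖ ^ (2 * k) ∂(sectorHaar D) := by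
  have h := integral_map (μ := sectorHaar D) (measurable_directSumUnitary D).aemeasurable
    (f := fun U => ‖(U : Matrix (QubitBasis D) (QubitBasis D) ℂ).trace‖ ^ (2 * k))
    (continuous_unitary_trace.norm.pow _).measurable.aestronglyMeasurable
  simp only [trace_directSumUnitary] at h
  exact h

/-- Makes every non-extreme sector large enough for the exact moments of all orders up to `D`. -/
theorem le_choose_of_pos_of_lt {D p : ℕ} (h0 : 0 < p) (hp : p < D) : D ≤ D.choose p := by
  obtain ⟨E, rfl⟩ : ∃ E, D = E + 1 := ⟨D - 1, by omega⟩
  obtain ⟨q, rfl⟩ : ∃ q, p = q + 1 := ⟨p - 1, by omega⟩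
  induction E generalizing q with
  | zero => omega
  | succ E ih =>
    rw [Nat.choose_succ_succ]
    rcases Nat.lt_or_ge (q + 1) (E + 1) with h | h
    · have := ih q (by omega) h
      have := Nat.choose_pos (show q ≤ E + 1 by omega)
      rw [Nat.succ_eq_add_one]
      omega
    · obtain rfl : q = E := by omega
      simp

theorem formFactor_sector_le {k : ℕ} (hk : k ≤ D) (p : Fin (D + 1)) :
    formFactor (haarUnitary (Sector D p)) k ≤ k.factorial := by
  by_cases h : 0 < (p : ℕ) ∧ (p : ℕ) < D
  · refine (formFactor_haarUnitary ?_).le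
    rw [Fintype.card_fin]
    exact hk.trans (le_choose_of_pos_of_lt h.1 h.2)
  · rw [formFactor_haarUnitary_of_card_eq_one]
    · exact_mod_cast k.factorial_pos
    · rw [Fintype.card_fin]
      have hp : (p : ℕ) = 0 ∨ (p : ℕ) = D := by omega
      rcases hp with hp | hp <;> simp [hp]

theorem formFactor_sector_one (p : Fin (D + 1)) : formFactor (haarUnitary (Sector D p)) 1 = 1 := by
  rw [formFactor_haarUnitary, Nat.factorial_one, Nat.cast_one]
  rw [Fintype.card_fin]
  exact Nat.choose_pos (Nat.lt_succ_iff.mp p.2)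

theorem integral_sector_phase (p : Fin (D + 1)) (a b : ℕ) (hab : a ≠ b) :
    ∫ U, (U p : Matrix (Sector D p) (Sector D p) ℂ).trace ^ a *
      (starRingEnd ℂ) (U p : Matrix (Sector D p) (Sector D p) ℂ).trace ^ b ∂(sectorHaar D) = 0 := by
  rw [← integral_trace_pow_mul_conj_trace_pow (n := Sector D p) hab]
  exact integral_sectorHaar_eval p (f := fun V =>
    (V : Matrix (Sector D p) (Sector D p) ℂ).trace ^ a *
      (starRingEnd ℂ) (V : Matrix (Sector D p) (Sector D p) ℂ).trace ^ b)
    ((continuous_unitary_trace.pow _).mul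
      (continuous_unitary_conj_trace.pow _)).measurable.stronglyMeasurable

theorem formFactor_symmetricHaar_le {k : ℕ} (hk : k ≤ D) :
    formFactor (symmetricHaar D) k ≤ k.factorial * ((D : ℝ) + 1) ^ k := by
  rw [formFactor_symmetricHaar]
  refine (integral_norm_sum_pow_le measurable_sector_trace
    (fun p U => norm_unitary_trace_le (U p)) iIndepFun_sector_trace integral_sector_phase
    (fun p m hm => (integral_norm_sector_trace_pow p m).trans_le
      (formFactor_sector_le (hm.trans hk) p)) Finset.univ k le_rfl).trans (le_of_eq ?_)
  simp

theorem le_formFactor_symmetricHaar {k : ℕ} (hk : k ≤ D) :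
    k.factorial * ((D : ℝ) - 1) ^ k ≤ formFactor (symmetricHaar D) k := by
  rcases Nat.eq_zero_or_pos D with rfl | hD
  · obtain rfl : k = 0 := by omega
    simp [formFactor]
  rw [formFactor_symmetricHaar, ← Nat.cast_one, ← Nat.cast_sub hD]
  let t : Finset (Fin (D + 1)) := {p | 0 < (p : ℕ) ∧ (p : ℕ) < D}
  have ht : D - 1 ≤ (Finset.univ ∩ t).card := by
    rw [Finset.univ_inter, ← Finset.card_map Fin.valEmbedding]
    calc D - 1 = (Finset.Ioo 0 D).card := by simp
      _ ≤ _ := Finset.card_le_card fun x hx => by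
        rw [Finset.mem_Ioo] at hx
        exact Finset.mem_map.mpr ⟨⟨x, by omega⟩,
          Finset.mem_filter.mpr ⟨Finset.mem_univ _, hx⟩, rfl⟩
  refine le_trans ?_ (le_integral_norm_sum_pow measurable_sector_trace
    (fun p U => norm_unitary_trace_le (U p)) iIndepFun_sector_trace integral_sector_phase
    (t := t) (fun p hp m hm => ?_) Finset.univ k le_rfl)
  · gcongr
  · rw [integral_norm_sector_trace_pow, formFactor_haarUnitary]
    rw [Fintype.card_fin]
    have hp' : 0 < (p : ℕ) ∧ (p : ℕ) < D := by simpa [t] using hp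
    exact (hm.trans hk).trans (le_choose_of_pos_of_lt hp'.1 hp'.2)

/-- Reindexing the conjugated factors removes `s`, so each pairing contributes equally; this is the
source of `k!`. Injectivity of `p` allows independence to split the integral. -/
theorem integral_prod_sectorTrace {k : ℕ} (p : Fin k ↪ Fin (D + 1)) (s : Equiv.Perm (Fin k)) :
    ∫ U, (∏ i, sectorTrace U (p i) * (starRingEnd ℂ) (sectorTrace U (p (s i))))
      ∂(symmetricHaar D) = ((∏ i, formFactor (haarUnitary (Sector D (p i))) 1 : ℝ) : ℂ) := by
  have hs : ∀ q : Fin (D + 1), Continuous fun U : Matrix.unitaryGroup (QubitBasis D) ℂ =>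
      sectorTrace U q := fun q => by
    simp only [sectorTrace, Matrix.trace, Matrix.diag_apply, Matrix.blockDiag'_apply]
    exact continuous_finsetSum _ fun i _ => continuous_unitary_entry _ _
  have hmeas : Continuous fun U : Matrix.unitaryGroup (QubitBasis D) ℂ =>
      ∏ i, sectorTrace U (p i) * (starRingEnd ℂ) (sectorTrace U (p (s i))) :=
    continuous_finsetProd _ fun i _ => (hs _).mul (Complex.continuous_conj.comp (hs _))
  rw [symmetricHaar, integral_map (measurable_directSumUnitary D).aemeasurable
    hmeas.measurable.aestronglyMeasurable]
  simp only [sectorTrace_directSumUnitary]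
  have h : ∀ U : ∀ p : Fin (D + 1), Matrix.unitaryGroup (Sector D p) ℂ,
      (∏ i, (U (p i) : Matrix (Sector D (p i)) (Sector D (p i)) ℂ).trace *
        (starRingEnd ℂ) (U (p (s i)) : Matrix (Sector D (p (s i))) (Sector D (p (s i))) ℂ).trace) =
      ((∏ i, ‖(U (p i) : Matrix (Sector D (p i)) (Sector D (p i)) ℂ).trace‖ ^ (2 * 1) : ℝ) : ℂ) := by
    intro U
    rw [Finset.prod_mul_distrib, Equiv.prod_comp s fun i =>
      (starRingEnd ℂ) (U (p i) : Matrix (Sector D (p i)) (Sector D (p i)) ℂ).trace,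
      ← Finset.prod_mul_distrib, Complex.ofReal_prod]
    refine Finset.prod_congr rfl fun i _ => ?_
    rw [Complex.mul_conj', mul_one, Complex.ofReal_pow]
  simp only [h]
  rw [integral_complex_ofReal, Complex.ofReal_inj]
  have hind := (iIndepFun_sector_trace (D := D)).comp (fun _ z => ‖z‖ ^ (2 * 1))
    (fun _ => (continuous_norm.pow _).measurable)
  have h2 := (hind.precomp p.injective).integral_fun_prod_eq_prod_integral
    (fun i => ((continuous_norm.pow _).measurable.comp
      (measurable_sector_trace (p i))).aestronglyMeasurable)
  refine h2.trans (Finset.prod_congr rfl fun i _ => ?_)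
  exact integral_norm_sector_trace_pow (p i) 1

theorem distinctSectorPart_eq_formFactor (D k : ℕ) : distinctSectorPart D k =
    (((k.factorial : ℝ) * ∑ p : Fin k ↪ Fin (D + 1),
      ∏ i, formFactor (haarUnitary (Sector D (p i))) 1 : ℝ) : ℂ) := by
  simp only [distinctSectorPart, integral_prod_sectorTrace, Finset.sum_const, Finset.card_univ,
    Fintype.card_perm, Fintype.card_fin, nsmul_eq_mul]
  rw [← Finset.mul_sum]
  push_cast
  rfl

theorem distinctSectorPart_eq (D k : ℕ) : distinctSectorPart D k =
    (((k.factorial : ℝ) * ((D + 1).descFactorial k : ℝ) : ℝ) : ℂ) := by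
  simp [distinctSectorPart_eq_formFactor, formFactor_sector_one, Finset.card_univ,
    Fintype.card_embedding_eq]

end Sectors

/-! ### Asymptotic comparison. -/

/-- Bernoulli's inequality for `1 - t/x ≥ -1`. The range `t ≤ 2x` admits `x = D + 1`, `t = 2` even
at `D = 0`. -/
theorem pow_mul_one_sub_le_sub_pow {x t : ℝ} (hx : 0 < x) (ht : t ≤ 2 * x) (k : ℕ) :
    x ^ k * (1 - k * t / x) ≤ (x - t) ^ k := by
  have h : -2 ≤ -(t / x) := by
    rw [neg_le_neg_iff, div_le_iff₀ hx]
    exact ht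
  have h1 := one_add_mul_le_pow h k
  have h2 : (x - t) ^ k = x ^ k * (1 + -(t / x)) ^ k := by
    rw [← mul_pow, mul_add, mul_one, mul_neg, mul_div_cancel₀ _ hx.ne', sub_eq_add_neg]
  rw [h2]
  refine mul_le_mul_of_nonneg_left (le_trans (le_of_eq ?_) h1) (by positivity)
  ring

theorem abs_formFactor_symmetricHaar_sub_le {D k : ℕ} {δ : ℝ} (hδ0 : 0 < δ) (hδ : δ ≤ 1 / 2)
    (hk : (k : ℝ) ≤ δ * D) :
    |formFactor (symmetricHaar D) k - (k.factorial : ℝ) * (D : ℝ) ^ k| ≤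
      2 * δ * ((k.factorial : ℝ) * (D : ℝ) ^ k) := by
  have hD0 : (0 : ℝ) ≤ D := D.cast_nonneg
  have hkD : k ≤ D := by exact_mod_cast (show (k : ℝ) ≤ D by nlinarith)
  have hle := formFactor_symmetricHaar_le hkD
  have hge := le_formFactor_symmetricHaar hkD
  have hf : (0 : ℝ) ≤ k.factorial := k.factorial.cast_nonneg
  have hpow := pow_nonneg hD0 k
  have hup : ((D : ℝ) + 1) ^ k ≤ (1 + 2 * δ) * (D : ℝ) ^ k := by
    have h1 := pow_mul_one_sub_le_sub_pow (x := (D : ℝ) + 1) (t := 1) (by linarith) (by linarith) k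
    have h2 : k * 1 / ((D : ℝ) + 1) ≤ δ := by
      rw [div_le_iff₀ (by linarith)]
      linarith
    rw [add_sub_cancel_right] at h1
    have h3 : ((D : ℝ) + 1) ^ k * (1 - δ) ≤ (D : ℝ) ^ k :=
      (mul_le_mul_of_nonneg_left (by linarith) (by positivity)).trans h1
    -- `(1 + 2δ)(1 - δ) ≥ 1` is exactly where `δ ≤ 1/2` enters.
    have h4 : ((D : ℝ) + 1) ^ k * 1 ≤ ((D : ℝ) + 1) ^ k * ((1 + 2 * δ) * (1 - δ)) :=
      mul_le_mul_of_nonneg_left (by nlinarith) (by positivity)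
    have h5 := mul_le_mul_of_nonneg_left h3 (show 0 ≤ 1 + 2 * δ by linarith)
    linarith
  have hlow : (1 - δ) * (D : ℝ) ^ k ≤ ((D : ℝ) - 1) ^ k := by
    rcases Nat.eq_zero_or_pos D with rfl | hD
    · obtain rfl : k = 0 := by omega
      simp [hδ0.le]
    have hD1 : (1 : ℝ) ≤ D := by exact_mod_cast hD
    refine le_trans ?_ (pow_mul_one_sub_le_sub_pow (by linarith) (by linarith) k)
    rw [mul_comm]
    refine mul_le_mul_of_nonneg_left ?_ hpow
    have : k * 1 / (D : ℝ) ≤ δ := by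
      rw [div_le_iff₀ (by linarith)]
      linarith
    linarith
  have h1 := mul_le_mul_of_nonneg_left hup hf
  have h2 := mul_le_mul_of_nonneg_left hlow hf
  have h3 := mul_nonneg hδ0.le (mul_nonneg hf hpow)
  rw [abs_le]
  constructor <;> linarith

theorem norm_formFactor_symmetricHaar_sub_distinctSectorPart_le {D k : ℕ} {δ : ℝ}
    (hδ0 : 0 < δ) (hδ : δ ≤ 1 / 4) (hk : (k : ℝ) ^ 2 ≤ δ * D) :
    ‖(formFactor (symmetricHaar D) k : ℂ) - distinctSectorPart D k‖ ≤
      4 * δ * formFactor (symmetricHaar D) k := by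
  have hD0 : (0 : ℝ) ≤ D := D.cast_nonneg
  have hkk : (k : ℝ) ≤ (k : ℝ) ^ 2 := by exact_mod_cast Nat.le_self_pow two_ne_zero k
  have hkD : k ≤ D := by exact_mod_cast (show (k : ℝ) ≤ D by nlinarith)
  have hle := formFactor_symmetricHaar_le hkD
  have hge := le_formFactor_symmetricHaar hkD
  have hf : (0 : ℝ) ≤ k.factorial := k.factorial.cast_nonneg
  have hpow : (0 : ℝ) ≤ ((D : ℝ) + 1) ^ k := by positivity
  have hq : (k : ℝ) ^ 2 / ((D : ℝ) + 1) ≤ δ := by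
    rw [div_le_iff₀ (by linarith)]
    linarith
  have hR : ((D : ℝ) + 1) ^ k * (1 - 2 * δ) ≤ ((D : ℝ) - 1) ^ k := by
    have h1 := pow_mul_one_sub_le_sub_pow (x := (D : ℝ) + 1) (t := 2) (by linarith) (by linarith) k
    rw [show (D : ℝ) + 1 - 2 = D - 1 by ring] at h1
    refine (mul_le_mul_of_nonneg_left ?_ hpow).trans h1
    have : k * 2 / ((D : ℝ) + 1) ≤ 2 * ((k : ℝ) ^ 2 / ((D : ℝ) + 1)) := by
      rw [← mul_div_assoc, mul_comm (k : ℝ) 2]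
      gcongr
    linarith
  -- Each factor of the falling factorial is at least `D + 1 - k`; Bernoulli with `t = k` then costs
  -- `k²/(D+1)`, hence the condition on `k²`.
  have hClow : ((D : ℝ) + 1) ^ k * (1 - δ) ≤ (D + 1).descFactorial k := by
    have hkD' : (k : ℝ) ≤ D := by exact_mod_cast hkD
    have h1 := pow_mul_one_sub_le_sub_pow (x := (D : ℝ) + 1) (t := k) (by linarith)
      (by linarith) k
    have h2 : ((D : ℝ) + 1 - k) ^ k ≤ (D + 1).descFactorial k := by
      have h3 : (D + 1 - k) ^ k ≤ (D + 1).descFactorial k :=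
        (Nat.pow_le_pow_left (by omega) k).trans (Nat.pow_sub_le_descFactorial (D + 1) k)
      have h4 : ((D : ℝ) + 1 - k) = ((D + 1 - k : ℕ) : ℝ) := by
        rw [Nat.cast_sub (by omega)]
        push_cast
        rfl
      rw [h4]
      exact_mod_cast h3
    refine ((mul_le_mul_of_nonneg_left ?_ hpow).trans h1).trans h2
    rw [← sq]
    linarith
  have hCup : ((D + 1).descFactorial k : ℝ) ≤ ((D : ℝ) + 1) ^ k := by
    exact_mod_cast Nat.descFactorial_le_pow (D + 1) k
  have h1 := mul_le_mul_of_nonneg_left hR hf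
  have h2 := mul_le_mul_of_nonneg_left hClow hf
  have h3 := mul_le_mul_of_nonneg_left hCup hf
  have hfP := mul_nonneg hf hpow
  -- Both quantities lie within `2δ k! (D+1)^k` below `k! (D+1)^k`. Since `1 - 2δ ≥ 1/2`, passing to
  -- an error relative to the form factor doubles this to `4δ`.
  have h4 : k.factorial * ((D : ℝ) + 1) ^ k ≤ 2 * formFactor (symmetricHaar D) k := by
    nlinarith
  have h5 := mul_le_mul_of_nonneg_left h4 hδ0.le
  have h6 := mul_nonneg hδ0.le hfP
  rw [distinctSectorPart_eq, ← Complex.ofReal_sub, Complex.norm_real, Real.norm_eq_abs, abs_le]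
  constructor <;> linarith

theorem mainTheorem3 :
    -- `R_{2k} ~ k! D ^ k`, uniformly as `k / D → 0`
    (∀ ε : ℝ, 0 < ε → ∃ δ : ℝ, 0 < δ ∧ ∀ D k : ℕ, (k : ℝ) ≤ δ * D →
      |formFactor (symmetricHaar D) k - (k.factorial : ℝ) * (D : ℝ) ^ k| ≤
        ε * ((k.factorial : ℝ) * (D : ℝ) ^ k)) ∧
    -- in each charge sector the Haar two-point form factor is `1`
    (∀ (D : ℕ) (p : Fin (D + 1)), formFactor (haarUnitary (Sector D p)) 1 = 1) ∧
    -- `k` distinct charge sectors contribute `k! ∑ R_2 ⋯ R_2`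
    (∀ D k : ℕ, distinctSectorPart D k =
      (((k.factorial : ℝ) * ∑ p : Fin k ↪ Fin (D + 1),
        ∏ i, formFactor (haarUnitary (Sector D (p i))) 1 : ℝ) : ℂ)) ∧
    -- this contribution is the leading term of `R_{2k}`, uniformly as `k ^ 2 / D → 0`
    (∀ ε : ℝ, 0 < ε → ∃ δ : ℝ, 0 < δ ∧ ∀ D k : ℕ, (k : ℝ) ^ 2 ≤ δ * D →
      ‖(formFactor (symmetricHaar D) k : ℂ) - distinctSectorPart D k‖ ≤
        ε * formFactor (symmetricHaar D) k) := by
  refine ⟨fun ε hε => ⟨min (1 / 2) (ε / 2), by positivity, fun D k hk => ?_⟩,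
    fun D p => formFactor_sector_one p, distinctSectorPart_eq_formFactor,
    fun ε hε => ⟨min (1 / 4) (ε / 4), by positivity, fun D k hk => ?_⟩⟩
  · refine (abs_formFactor_symmetricHaar_sub_le (by positivity) (min_le_left _ _) hk).trans ?_
    refine mul_le_mul_of_nonneg_right ?_ (by positivity)
    linarith [min_le_right (1 / 2) (ε / 2)]
  · refine (norm_formFactor_symmetricHaar_sub_distinctSectorPart_le (by positivity)
      (min_le_left _ _) hk).trans ?_
    refine mul_le_mul_of_nonneg_right ?_ (integral_nonneg fun U => by positivity)
    linarith [min_le_right (1 / 4) (ε / 4)]
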